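/- Let $J=[-1,1]$, $J_s=J\times\{s\}$ for $s\in\{-1,1\}$, and let $\partial J^2$ be the boundary of the square $J^2\subset\mathbb R^2$. An arc is a space homeomorphic to $[0,1]$, a disc is a space homeomorphic to the closed unit disc, and a circle is a space homeomorphic to the unit circle. For an arc or a disc $M$, $\partial M$ denotes its boundary (the endpoint set of an arc, the boundary circle of a disc) and $\mathring M=M\setminus\partial M$ its interior. A nonempty compact connected set $X\subset J^2$ is a *hanging set on $J_s$* if $X\cap\partial J^2$ is a nonempty connected set contained in $\mathring J_s$. A *hutch* of a hanging set $X$ on $J_s$ is a disc $D\subset J^2$ that is itself a hanging set on $J_s$, such that $D\cap\partial J^2$ is an arc, $X\cap J_s$ is contained in the interior of the arc $D\cap J_s$, and $X\setminus J_s\subset\mathring D$. A hanging set $X$ on $J_s$ is *permeable* if there are a hutch $D$ of $X$ and a continuous map $\eta:D\to D$ such that, writing $A=D\cap J_s$, 1. $\eta$ is the identity on $\partial D\setminus\mathring A$, $\eta(A)=A\cup X$, and there is an arc $A'\subset\mathring A$ such that $X\cap J_s\subset\mathring{A'}$, $\eta(A\setminus A')=A\setminus(X\cap J_s)$, $\eta(A')=X$,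 and $\eta|_{A\setminus A'}$ is injective; 2. $\eta(\mathring D)=\mathring D\setminus X$, and $\eta|_{\mathring D}$ is injective. **Proposition.** Let $s\in\{-1,1\}$ and let $X$ be a hanging set on $J_s$. If $X$ is permeable, then $X$ is a dendrite, that is, $X$ is a Peano continuum (a compact, connected, locally connected metric space) containing no circle. -/

import Mathlib

open Set

namespace Permeating

/-- The square `J²`, where `J = [-1, 1]`. All notions below are topological, so the plane is
taken to be `ℝ × ℝ` with its usual topology. -/
def square : Set (ℝ × ℝ) := Icc (-1 : ℝ) 1 ×ˢ Icc (-1 : ℝ) 1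

/-- The segment `J_s = J × {s}`. -/
def edge (s : ℝ) : Set (ℝ × ℝ) := Icc (-1 : ℝ) 1 ×ˢ {s}

/-- The segment `J_s` without its two endpoints. -/
def openEdge (s : ℝ) : Set (ℝ × ℝ) := Ioo (-1 : ℝ) 1 ×ˢ {s}

/-- An arc: a set homeomorphic to `[0, 1]`. -/
def IsArc (I : Set (ℝ × ℝ)) : Prop := Nonempty (I ≃ₜ unitInterval)

/-- The endpoint set of an arc `I`: the points that correspond to `0` or `1` under a
homeomorphism `I ≃ₜ [0, 1]` (it does not matter under which one). -/
def arcEndpoints (I : Set (ℝ × ℝ)) : Set (ℝ × ℝ) :=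
  {x | ∃ (h : I ≃ₜ unitInterval) (hx : x ∈ I), h ⟨x, hx⟩ = 0 ∨ h ⟨x, hx⟩ = 1}

/-- The interior of an arc (as a manifold with boundary): the arc without its endpoints. -/
def arcInterior (I : Set (ℝ × ℝ)) : Set (ℝ × ℝ) := I \ arcEndpoints I

/-- A disc: a set homeomorphic to the closed unit disc. -/
def IsDisc (D : Set (ℝ × ℝ)) : Prop := Nonempty (D ≃ₜ Metric.closedBall (0 : ℂ) 1)

/-- The boundary of a disc `D` (as a manifold with boundary): the points that correspond to points
of the unit circle under a homeomorphism of `D` with the closed unit disc. It does not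
matter under which one, and for a disc in the plane this is also its topological frontier. -/
def discBoundary (D : Set (ℝ × ℝ)) : Set (ℝ × ℝ) :=
  {x | ∃ (h : D ≃ₜ Metric.closedBall (0 : ℂ) 1) (hx : x ∈ D), ‖(h ⟨x, hx⟩ : ℂ)‖ = 1}

/-- The interior of a disc (as a manifold with boundary). For a disc in the plane this is also its
topological interior. -/
def discInterior (D : Set (ℝ × ℝ)) : Set (ℝ × ℝ) := D \ discBoundary D

/-- `X` is a hanging set on `J_s`: a nonempty compact connected subset of the square that meets
the boundary of the square in a nonempty connected set, contained in the open segment. -/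
structure IsHanging (s : ℝ) (X : Set (ℝ × ℝ)) : Prop where
  subset_square : X ⊆ square
  isCompact : IsCompact X
  isConnected : IsConnected X
  isConnected_inter : IsConnected (X ∩ frontier square)
  inter_subset : X ∩ frontier square ⊆ openEdge s

/-- `D` is a hutch of the hanging set `X` on `J_s`. -/
structure IsHutch (s : ℝ) (X D : Set (ℝ × ℝ)) : Prop where
  isDisc : IsDisc D
  isHanging : IsHanging s D
  isArc_inter : IsArc (D ∩ frontier square)
  inter_edge_subset : X ∩ edge s ⊆ arcInterior (D ∩ edge s)
  diff_edge_subset : X \ edge s ⊆ discInterior D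

/-- `η` restricts to a continuous map `D → D` that is a permeating from `A = D ∩ J_s` to `X`.
Only the values of `η` on `D` matter. -/
structure IsPermeating (s : ℝ) (X D : Set (ℝ × ℝ)) (η : ℝ × ℝ → ℝ × ℝ) : Prop where
  continuousOn : ContinuousOn η D
  mapsTo : MapsTo η D D
  eqOn_id : EqOn η id (discBoundary D \ arcInterior (D ∩ edge s))
  image_arc : η '' (D ∩ edge s) = (D ∩ edge s) ∪ X
  exists_subarc : ∃ A' : Set (ℝ × ℝ), IsArc A' ∧ A' ⊆ arcInterior (D ∩ edge s) ∧
    X ∩ edge s ⊆ arcInterior A' ∧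
    η '' ((D ∩ edge s) \ A') = (D ∩ edge s) \ (X ∩ edge s) ∧
    η '' A' = X ∧
    InjOn η ((D ∩ edge s) \ A')
  image_interior : η '' discInterior D = discInterior D \ X
  injOn_interior : InjOn η (discInterior D)

/-- A hanging set `X` on `J_s` is permeable if for some hutch `D` of `X` there is a permeating
from `D ∩ J_s` to `X`. -/
def IsPermeable (s : ℝ) (X : Set (ℝ × ℝ)) : Prop :=
  IsHanging s X ∧ ∃ D : Set (ℝ × ℝ), IsHutch s X D ∧ ∃ η : ℝ × ℝ → ℝ × ℝ, IsPermeating s X D η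

/-- A Peano continuum: a locally connected, connected, compact metrizable (nonempty) space. -/
structure IsPeanoContinuum (T : Type*) [TopologicalSpace T] : Prop where
  compactSpace : CompactSpace T
  connectedSpace : ConnectedSpace T
  metrizableSpace : TopologicalSpace.MetrizableSpace T
  locallyConnectedSpace : LocallyConnectedSpace T

/-- A dendrite: a Peano continuum with no subspace homeomorphic to the circle. -/
structure IsDendrite (T : Type*) [TopologicalSpace T] : Prop where
  isPeanoContinuum : IsPeanoContinuum T
  no_circle : ∀ C : Set T, ¬ Nonempty (C ≃ₜ Circle)

end Permeating

/-! Local connectedness passes to `X` because `X = η(A')` is a Hausdorff quotient of the arc `A'`.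

For the absence of circles, carry `D` to the closed unit disc and let `K` be the image of `X`. The
conjugate of `η` maps the open disc onto the open disc minus `K`, which is therefore path connected.
Since `A'` lies in the closure of the interior of `D`, continuity makes this complement accumulate
at every point of `K`. Some boundary point `p` is not in `K`, as otherwise the whole boundary circle
of `D` would embed in the line containing `J_s`. A simple closed curve in `K` would enclose a
bounded region inside the open disc. By density the region contains a point off `K`, from which one
can reach `p` and leave the disc without meeting `K`: a contradiction
(`not_range_subset_of_isPathConnected_sdiff`).

The plane topology rests on continuous logarithms. They give the crossing of paths in a rectangle,
from which `exists_isBounded_pathComponentIn_compl_range` derives the separation half of the Jordan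
curve theorem, and they show that the boundary of a disc is well defined. -/

/-! ### Continuous logarithms and crossing paths. -/

/-- A nowhere vanishing continuous function on a convex set has a continuous logarithm. -/
theorem Convex.exists_continuousOn_exp_eq {E : Type*} [NormedAddCommGroup E] [NormedSpace ℝ E]
    {S : Set E} (hS : Convex ℝ S) {g : E → ℂ} (hg : ContinuousOn g S) (h0 : ∀ x ∈ S, g x ≠ 0) :
    ∃ L : E → ℂ, ContinuousOn L S ∧ ∀ x ∈ S, Complex.exp (L x) = g x := by
  classical
  rcases S.eq_empty_or_nonempty with rfl | hne
  · exact ⟨0, by simp, by simp⟩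
  have := hS.contractibleSpace hne
  have := hS.locallyPathConnectedSpace
  obtain ⟨x₀, hx₀⟩ := hne
  rcases Complex.isCoveringMapOn_exp.existsUnique_continuousMap_lifts
    (⟨S.domRestrict g, continuousOn_iff_continuous_domRestrict.mp hg⟩ : C(S, ℂ)) (a₀ := ⟨x₀, hx₀⟩)
    (Complex.exp_log (h0 x₀ hx₀)) (fun x ↦ h0 x x.2) with ⟨f, ⟨-, hf⟩, -⟩
  refine ⟨fun z ↦ if hz : z ∈ S then f ⟨z, hz⟩ else 0, ?_, ?_⟩
  · rw [continuousOn_iff_continuous_domRestrict]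
    convert! map_continuous f
    ext z
    simp
  · intro x hx
    simpa [hx] using congr_fun hf ⟨x, hx⟩

/-- A continuous function on `[0, 1]` along which `sin` is nonnegative stays in one of the
intervals `[2πk, 2πk + π]`. -/
theorem exists_int_mem_Icc_of_sin_nonneg {φ : ℝ → ℝ} (hφ : ContinuousOn φ (Icc 0 1))
    (h : ∀ t ∈ Icc (0 : ℝ) 1, 0 ≤ Real.sin (φ t)) :
    ∃ k : ℤ, ∀ t ∈ Icc (0 : ℝ) 1,
      φ t ∈ Icc (k * (2 * Real.pi)) (k * (2 * Real.pi) + Real.pi) := by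
  have hpi := Real.pi_pos
  have h01 : (0 : ℝ) ∈ Icc (0 : ℝ) 1 := by simp
  have hconn : OrdConnected (φ '' Icc 0 1) := (isPreconnected_Icc.image φ hφ).ordConnected
  have hsin : ∀ (k : ℤ) (x : ℝ), Real.sin (k * (2 * Real.pi) + x) = Real.sin x := by
    intro k x
    rw [add_comm, Real.sin_add_int_mul_two_pi]
  -- The gaps `(2πk - π, 2πk)`, where the sine is negative, are missed by the image, which is an
  -- interval and so cannot jump over one.
  have hneg : ∀ (k : ℤ) (x : ℝ), -Real.pi < x → x < 0 →
      k * (2 * Real.pi) + x ∉ φ '' Icc 0 1 := by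
    rintro k x h1 h2 ⟨t, ht, hx⟩
    have := h t ht
    rw [hx, hsin] at this
    exact this.not_gt (Real.sin_neg_of_neg_of_neg_pi_lt h2 h1)
  obtain ⟨k, hk1, hk2⟩ : ∃ k : ℤ, k * (2 * Real.pi) ≤ φ 0 ∧ φ 0 < (k + 1) * (2 * Real.pi) := by
    refine ⟨⌊φ 0 / (2 * Real.pi)⌋, ?_, ?_⟩
    · rw [← le_div_iff₀ (by positivity)]; exact Int.floor_le _
    · rw [← div_lt_iff₀ (by positivity)]; exact Int.lt_floor_add_one _
  have hmem : ∀ t ∈ Icc (0 : ℝ) 1, φ t ∈ φ '' Icc 0 1 := fun t ht => mem_image_of_mem φ ht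
  have h0 : φ 0 ≤ k * (2 * Real.pi) + Real.pi := by
    by_contra! hlt
    refine hneg (k + 1) (φ 0 - (k + 1) * (2 * Real.pi)) (by linarith) (by linarith) ?_
    push_cast
    convert hmem 0 h01 using 1
    ring
  refine ⟨k, fun t ht => ⟨?_, ?_⟩⟩
  · by_contra! hlt
    -- `φ t` may lie below the gap; the maximum with its midpoint yields a point of the gap between
    -- `φ t` and `φ 0`.
    refine hneg k (max (-Real.pi / 2) (φ t - k * (2 * Real.pi))) (lt_max_of_lt_left (by linarith))
      (max_lt (by linarith) (by linarith)) ?_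
    refine hconn.out (hmem t ht) (hmem 0 h01) ⟨?_, ?_⟩
    · linarith [le_max_right (-Real.pi / 2) (φ t - k * (2 * Real.pi))]
    · linarith [max_le (a := -Real.pi / 2) (b := φ t - k * (2 * Real.pi)) (c := 0) (by linarith)
        (by linarith)]
  · by_contra! hlt
    refine hneg (k + 1) (min (-Real.pi / 2) (φ t - (k + 1) * (2 * Real.pi)))
      (lt_min (by linarith) (by linarith)) (min_lt_of_left_lt (by linarith)) ?_
    push_cast
    refine hconn.out (hmem 0 h01) (hmem t ht) ⟨?_, ?_⟩
    · have : -Real.pi ≤ min (-Real.pi / 2) (φ t - (k + 1) * (2 * Real.pi)) :=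
        le_min (by linarith) (by linarith)
      linarith
    · linarith [min_le_right (-Real.pi / 2) (φ t - (k + 1) * (2 * Real.pi))]

theorem Path.extend_mem {X : Type*} [TopologicalSpace X] {x y : X} {γ : Path x y} {F : Set X}
    (h : ∀ t, γ t ∈ F) (t : ℝ) : γ.extend t ∈ F := by
  have : γ.extend t ∈ range γ.extend := mem_range_self t
  rw [Path.extend_range] at this
  obtain ⟨u, hu⟩ := this
  exact hu ▸ h u

/-- The rectangle `[-1, 1] × [-2, 2]` in the complex plane. -/
def crossingRect : Set ℂ := {z | |z.re| ≤ 1 ∧ |z.im| ≤ 2}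

/-- A path joining the vertical sides of a rectangle meets every path joining the
horizontal sides. -/
theorem inter_nonempty_of_joinedIn_of_joinedIn {S T : Set ℂ} {a b c d : ℂ}
    (hS : S ⊆ crossingRect) (hT : T ⊆ crossingRect) (hab : JoinedIn S a b) (hcd : JoinedIn T c d)
    (ha : a.re = -1) (hb : b.re = 1) (hc : c.im = -2) (hd : d.im = 2) : (S ∩ T).Nonempty := by
  by_contra hne
  obtain ⟨γ, hγ⟩ := hab
  obtain ⟨δ, hδ⟩ := hcd
  have hγ' : ∀ t, γ.extend t ∈ S := Path.extend_mem hγ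
  have hδ' : ∀ t, δ.extend t ∈ T := Path.extend_mem hδ
  -- If the paths are disjoint, `γ(s) - δ(t)` never vanishes and has a logarithm, although its
  -- values turn once around zero along the boundary of the parameter square.
  obtain ⟨L, hLc, hL⟩ := (convex_univ (𝕜 := ℝ) (E := ℝ × ℝ)).exists_continuousOn_exp_eq
    (g := fun p => γ.extend p.1 - δ.extend p.2)
    ((γ.continuous_extend.comp continuous_fst).sub
      (δ.continuous_extend.comp continuous_snd)).continuousOn
    (fun p _ h => hne ⟨_, hγ' p.1, by rw [sub_eq_zero.mp h]; exact hδ' p.2⟩)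
  have hLc' : Continuous fun p => (L p).im :=
    Complex.continuous_im.comp (continuousOn_univ.mp hLc)
  have hv : ∀ s, Continuous fun t => (L (s, t)).im := fun s =>
    hLc'.comp (Continuous.prodMk_right s)
  have hh : ∀ t, Continuous fun s => (L (s, t)).im := fun t =>
    hLc'.comp (Continuous.prodMk_left t)
  have hre : ∀ p : ℝ × ℝ, Real.exp (L p).re * Real.cos (L p).im
      = (γ.extend p.1).re - (δ.extend p.2).re := fun p => by
    rw [← Complex.exp_re, hL p (mem_univ _), Complex.sub_re]
  have him : ∀ p : ℝ × ℝ, Real.exp (L p).re * Real.sin (L p).im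
      = (γ.extend p.1).im - (δ.extend p.2).im := fun p => by
    rw [← Complex.exp_im, hL p (mem_univ _), Complex.sub_im]
  have bS : ∀ t, |(γ.extend t).re| ≤ 1 ∧ |(γ.extend t).im| ≤ 2 := fun t => hS (hγ' t)
  have bT : ∀ t, |(δ.extend t).re| ≤ 1 ∧ |(δ.extend t).im| ≤ 2 := fun t => hT (hδ' t)
  have nonneg_of : ∀ x y : ℝ, 0 ≤ Real.exp x * y → 0 ≤ y := fun x y h =>
    nonneg_of_mul_nonneg_right h (Real.exp_pos x)
  -- On the four sides the difference stays in the right, upper, left and lower half plane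
  -- respectively; the shifts rotate each of these to the upper one.
  obtain ⟨k₁, h₁⟩ := exists_int_mem_Icc_of_sin_nonneg (φ := fun t => (L (1, t)).im + Real.pi / 2)
    ((hv 1).add continuous_const).continuousOn (fun t _ => by
      rw [Real.sin_add_pi_div_two]
      refine nonneg_of _ _ (by rw [hre, γ.extend_one, hb]; linarith [abs_le.mp (bT t).1]))
  obtain ⟨k₂, h₂⟩ := exists_int_mem_Icc_of_sin_nonneg (φ := fun t => (L (t, 0)).im)
    (hh 0).continuousOn (fun t _ => by
      refine nonneg_of _ _ (by rw [him, δ.extend_zero, hc]; linarith [abs_le.mp (bS t).2]))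
  obtain ⟨k₃, h₃⟩ := exists_int_mem_Icc_of_sin_nonneg (φ := fun t => (L (0, t)).im - Real.pi / 2)
    ((hv 0).sub continuous_const).continuousOn (fun t _ => by
      rw [Real.sin_sub_pi_div_two]
      refine nonneg_of (L (0, t)).re _ ?_
      rw [mul_neg, hre, γ.extend_zero, ha]; linarith [abs_le.mp (bT t).1])
  obtain ⟨k₄, h₄⟩ := exists_int_mem_Icc_of_sin_nonneg (φ := fun t => (L (t, 1)).im - Real.pi)
    ((hh 1).sub continuous_const).continuousOn (fun t _ => by
      rw [Real.sin_sub_pi]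
      refine nonneg_of (L (t, 1)).re _ ?_
      rw [mul_neg, him, δ.extend_one, hd]; linarith [abs_le.mp (bS t).2])
  have m0 : (0 : ℝ) ∈ Icc (0 : ℝ) 1 := by simp
  have m1 : (1 : ℝ) ∈ Icc (0 : ℝ) 1 := by simp
  have hpi := Real.pi_pos
  have le_of : ∀ k l : ℤ, (k : ℝ) * (2 * Real.pi) < l * (2 * Real.pi) + 2 * Real.pi → k ≤ l := by
    intro k l h
    have : (k : ℝ) < l + 1 := by
      refine lt_of_mul_lt_mul_right (a := 2 * Real.pi) (by linarith) (by positivity)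
    exact_mod_cast Int.lt_add_one_iff.mp (by exact_mod_cast this)
  have a1 := h₁ 0 m0
  have a2 := h₂ 1 m1
  have b2 := h₂ 0 m0
  have b3 := h₃ 0 m0
  have c3 := h₃ 1 m1
  have c4 := h₄ 0 m0
  have d4 := h₄ 1 m1
  have d1 := h₁ 1 m1
  simp only [mem_Icc] at a1 a2 b2 b3 c3 c4 d4 d1
  -- Comparing adjacent sides at the common corners gives `k₁ ≤ k₂ ≤ k₃ ≤ k₄ ≤ k₁ - 1`.
  have e1 := le_of k₁ k₂ (by linarith)
  have e2 := le_of k₂ k₃ (by linarith)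
  have e3 := le_of k₃ k₄ (by linarith)
  have e4 : k₄ + 1 ≤ k₁ := le_of (k₄ + 1) k₁ (by push_cast; linarith)
  omega

/-- The identity minus `q` has no continuous logarithm on a circle around `q`. -/
theorem not_exists_log_on_sphere (q : ℂ) {r : ℝ} (hr : 0 < r) (L : ℂ → ℂ)
    (hL : ContinuousOn L (Metric.sphere q r)) :
    ¬ ∀ z ∈ Metric.sphere q r, Complex.exp (L z) = z - q := by
  intro h
  have hmem : ∀ θ : ℝ, circleMap q r θ ∈ Metric.sphere q r := fun θ =>
    circleMap_mem_sphere q hr.le θ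
  -- A logarithm would keep `m` in `2πℤ`, so `cos m > 0`; but `m` drops by `2π` over one turn and
  -- passes `m 0 - π`, where the cosine changes sign.
  set m : ℝ → ℝ := fun θ => (L (circleMap q r θ)).im - θ with hm
  have hc : Continuous m := by
    have : Continuous fun θ => L (circleMap q r θ) :=
      hL.comp_continuous (continuous_circleMap q r) hmem
    exact (Complex.continuous_im.comp this).sub continuous_id
  have hpos : ∀ θ, 0 < Real.cos (m θ) := by
    intro θ
    have h1 : Complex.exp (L (circleMap q r θ) - θ * Complex.I) = r := by
      rw [Complex.exp_sub, h _ (hmem θ), circleMap, add_sub_cancel_left,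
        mul_div_cancel_right₀ _ (Complex.exp_ne_zero _)]
    have h2 := congr_arg Complex.re h1
    rw [Complex.exp_re] at h2
    simp only [Complex.sub_im, Complex.mul_im, Complex.ofReal_re, Complex.I_im, Complex.ofReal_im,
      Complex.I_re, mul_one, mul_zero, add_zero] at h2
    exact pos_of_mul_pos_right (h2 ▸ hr) (Real.exp_pos _).le
  have h2pi : m (2 * Real.pi) = m 0 - 2 * Real.pi := by
    have : circleMap q r (2 * Real.pi) = circleMap q r 0 := by
      simpa using periodic_circleMap q r 0
    simp [hm, this]
  obtain ⟨θ, -, hθ⟩ := intermediate_value_Icc' Real.two_pi_pos.le hc.continuousOn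
    (show m 0 - Real.pi ∈ Icc (m (2 * Real.pi)) (m 0) by
      rw [h2pi]; constructor <;> linarith [Real.pi_pos])
  have := hpos θ
  rw [hθ, Real.cos_sub_pi] at this
  linarith [hpos 0]

/-! ### A simple closed curve encloses a bounded region. -/

theorem joinedIn_vertical {F : Set ℂ} {x y y' : ℝ} (h : ∀ t ∈ uIcc y y', (⟨x, t⟩ : ℂ) ∈ F) :
    JoinedIn F ⟨x, y⟩ ⟨x, y'⟩ := by
  have hc : Continuous fun t : ℝ => (⟨x, t⟩ : ℂ) :=
    Complex.equivRealProdCLM.symm.continuous.comp (Continuous.prodMk_right x)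
  have := (((convex_uIcc y y').isPathConnected nonempty_uIcc).image hc).joinedIn
    _ (mem_image_of_mem _ left_mem_uIcc) _ (mem_image_of_mem _ right_mem_uIcc)
  exact this.mono (image_subset_iff.mpr h)

theorem joinedIn_horizontal {F : Set ℂ} {x x' y : ℝ} (h : ∀ t ∈ uIcc x x', (⟨t, y⟩ : ℂ) ∈ F) :
    JoinedIn F ⟨x, y⟩ ⟨x', y⟩ := by
  have hc : Continuous fun t : ℝ => (⟨t, y⟩ : ℂ) :=
    Complex.equivRealProdCLM.symm.continuous.comp (Continuous.prodMk_left y)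
  have := (((convex_uIcc x x').isPathConnected nonempty_uIcc).image hc).joinedIn
    _ (mem_image_of_mem _ left_mem_uIcc) _ (mem_image_of_mem _ right_mem_uIcc)
  exact this.mono (image_subset_iff.mpr h)

/-- A path leaving a sublevel set `{φ < c}` can be stopped on the level set `{φ = c}`. -/
theorem JoinedIn.exists_level {X : Type*} [TopologicalSpace X] {F : Set X} {x y : X}
    (h : JoinedIn F x y) {φ : X → ℝ} (hφ : Continuous φ) {c : ℝ} (hx : φ x < c) (hy : c ≤ φ y) :
    ∃ w, φ w = c ∧ JoinedIn (F ∩ {z | φ z ≤ c}) x w := by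
  obtain ⟨γ, hγ⟩ := h
  set g : ℝ → X := fun t => γ.extend t
  have hgc : Continuous g := γ.continuous_extend
  have hgF : ∀ t, g t ∈ F := Path.extend_mem hγ
  have h0 : g 0 = x := γ.extend_zero
  have h1 : g 1 = y := γ.extend_one
  obtain ⟨t, ⟨ht, htc⟩, hmin⟩ := (isCompact_Icc.inter_right
    (isClosed_le continuous_const (hφ.comp hgc))).exists_isLeast
    (show (Icc (0 : ℝ) 1 ∩ {t | c ≤ (φ ∘ g) t}).Nonempty from ⟨1, by simp, by simpa [h1] using hy⟩)
  obtain ⟨u, hu, huc⟩ := intermediate_value_Icc ht.1 (hφ.comp hgc).continuousOn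
    (show c ∈ Icc ((φ ∘ g) 0) ((φ ∘ g) t) from ⟨by simpa [h0] using hx.le, htc⟩)
  have htu : t = u := le_antisymm (hmin ⟨⟨hu.1, hu.2.trans ht.2⟩, huc.ge⟩) hu.2
  subst htu
  refine ⟨g t, huc, ?_⟩
  have := (((convex_Icc 0 t).isPathConnected ⟨t, hu⟩).image hgc).joinedIn
    _ (mem_image_of_mem _ (left_mem_Icc.mpr ht.1)) _ (mem_image_of_mem _ hu)
  rw [h0] at this
  refine this.mono ?_
  rintro _ ⟨v, hv, rfl⟩
  refine ⟨hgF v, ?_⟩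
  rcases hv.2.eq_or_lt with rfl | hvt
  · exact huc.le
  · by_contra hcv
    exact hvt.not_ge (hmin ⟨⟨hv.1, hv.2.trans ht.2⟩, show c ≤ φ (g v) from (not_le.mp hcv).le⟩)

/-- Two arcs from `-1` to `1` in the rectangle, disjoint away from their ends and with
interiors `A` and `B`, bound a region: the form in which the highest point of `A ∪ B` on the
imaginary axis belongs to `A`. -/
theorem exists_isBounded_pathComponentIn_of_highest_mem {A B : Set ℂ} (hA : IsPathConnected A)
    (hKA : IsCompact (A ∪ {-1, 1})) (hKB : IsCompact (B ∪ {-1, 1}))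
    (hjA : JoinedIn (A ∪ {-1, 1}) (-1) 1) (hjB : JoinedIn (B ∪ {-1, 1}) (-1) 1)
    (hdisj : Disjoint A B) (hb : ∀ z ∈ A ∪ B, |z.re| < 1 ∧ |z.im| < 2)
    {l : ℂ} (hlA : l ∈ A) (hl0 : l.re = 0) (hl : ∀ z ∈ A ∪ B, z.re = 0 → z.im ≤ l.im) :
    ∃ z₀ ∉ A ∪ B ∪ {-1, 1},
      Bornology.IsBounded (pathComponentIn (A ∪ B ∪ {-1, 1})ᶜ z₀) := by
  have hR1 : ({-1, 1} : Set ℂ) ⊆ crossingRect := by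
    rintro z (rfl | rfl) <;> simp [crossingRect]
  have hRA : A ∪ {-1, 1} ⊆ crossingRect :=
    union_subset (fun z hz => ⟨(hb z (.inl hz)).1.le, (hb z (.inl hz)).2.le⟩) hR1
  have hRB : B ∪ {-1, 1} ⊆ crossingRect :=
    union_subset (fun z hz => ⟨(hb z (.inr hz)).1.le, (hb z (.inr hz)).2.le⟩) hR1
  have noJoin : ∀ K : Set ℂ, K ⊆ crossingRect → JoinedIn K (-1) 1 →
      ¬ JoinedIn (crossingRect \ K) ⟨0, 2⟩ ⟨0, -2⟩ := by
    intro K hK hj hj'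
    obtain ⟨z, hz, hz'⟩ := inter_nonempty_of_joinedIn_of_joinedIn hK sdiff_subset hj hj'.symm
      (by simp) (by simp) rfl rfl
    exact hz'.2 hz
  have noA := noJoin _ hRA hjA
  have noB := noJoin _ hRB hjB
  have ne1 : ∀ t : ℝ, (⟨0, t⟩ : ℂ) ∉ ({-1, 1} : Set ℂ) := by
    rintro t (h | h) <;> simpa using congr_arg Complex.re h
  have memR : ∀ t : ℝ, |t| ≤ 2 → (⟨0, t⟩ : ℂ) ∈ crossingRect := fun t ht => ⟨by simp, ht⟩
  have eq0 : ∀ z : ℂ, z.re = 0 → z = ⟨0, z.im⟩ := fun z hz => Complex.ext hz rfl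
  have hcl : IsClosed {z : ℂ | z.re = 0} := isClosed_eq Complex.continuous_re continuous_const
  -- `m` is the lowest point of `A` on the axis. One can descend from the top to `l` and follow `A`
  -- to `m` without meeting `B`.
  obtain ⟨m, ⟨hmA, hm0⟩, hm⟩ := (hKA.inter_right hcl).exists_isMinOn ⟨l, .inl hlA, hl0⟩
    Complex.continuous_im.continuousOn
  replace hmA : m ∈ A := hmA.resolve_right (eq0 m hm0 ▸ ne1 _)
  have belowA : ∀ t : ℝ, t < m.im → (⟨0, t⟩ : ℂ) ∉ A ∪ {-1, 1} := fun t ht h =>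
    ht.not_ge (hm ⟨h, rfl⟩)
  have hAB : A ⊆ crossingRect \ (B ∪ {-1, 1}) := fun z hz => ⟨hRA (.inl hz), by
    rintro (h | h)
    · exact hdisj.ne_of_mem hz h rfl
    · have := (hb z (.inl hz)).1
      rcases h with rfl | rfl <;> simp at this⟩
  have hbl := abs_lt.mp (hb l (.inl hlA)).2
  have hbm := abs_lt.mp (hb m (.inl hmA)).2
  have top : JoinedIn (crossingRect \ (B ∪ {-1, 1})) ⟨0, 2⟩ m := by
    refine JoinedIn.trans (y := l) ?_ ((hA.joinedIn l hlA m hmA).mono hAB)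
    rw [eq0 l hl0]
    refine joinedIn_vertical fun t ht => ?_
    rw [uIcc_of_ge hbl.2.le] at ht
    rcases ht.1.eq_or_lt with h | h
    · rw [← h, ← eq0 l hl0]; exact hAB hlA
    · refine ⟨memR t (abs_le.mpr ⟨by linarith, ht.2⟩), ?_⟩
      rintro (h' | h')
      · exact h.not_ge (hl _ (.inr h') rfl)
      · exact ne1 t h'
  have hcl' : IsClosed {z : ℂ | z.re = 0 ∧ z.im ≤ m.im} :=
    hcl.inter (isClosed_le Complex.continuous_im continuous_const)
  -- Otherwise the descent could continue from `m` to the bottom, avoiding a path that joins the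
  -- vertical sides.
  have hne : ((B ∪ {-1, 1}) ∩ {z : ℂ | z.re = 0 ∧ z.im ≤ m.im}).Nonempty := by
    by_contra hemp
    refine noB (top.trans ?_)
    rw [eq0 m hm0]
    refine joinedIn_vertical fun t ht => ?_
    rw [uIcc_of_ge hbm.1.le] at ht
    exact ⟨memR t (abs_le.mpr ⟨ht.1, by linarith [ht.2]⟩), fun h => hemp ⟨_, h, rfl, ht.2⟩⟩
  obtain ⟨p, ⟨hpB, hp0, hpm⟩, hp⟩ := (hKB.inter_right hcl').exists_isMaxOn hne
    Complex.continuous_im.continuousOn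
  replace hpB : p ∈ B := hpB.resolve_right (eq0 p hp0 ▸ ne1 _)
  have hbp := abs_lt.mp (hb p (.inr hpB)).2
  have hlt : p.im < m.im := lt_of_le_of_ne hpm fun h =>
    hdisj.ne_of_mem hmA hpB (Complex.ext (hm0.trans hp0.symm) h.symm)
  have betweenB : ∀ t : ℝ, p.im < t → t ≤ m.im → (⟨0, t⟩ : ℂ) ∉ B ∪ {-1, 1} := fun t h1 h2 h =>
    h1.not_ge (hp ⟨h, rfl, h2⟩)
  -- The enclosed point is chosen on the axis between `m` and `p`, the highest point of `B` below
  -- `m`.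
  obtain ⟨c, hpc, hcm⟩ := exists_between hlt
  have hc2 : |c| < 2 := abs_lt.mpr ⟨by linarith, by linarith⟩
  have hcK : (⟨0, c⟩ : ℂ) ∉ A ∪ B ∪ {-1, 1} := by
    rintro ((h | h) | h)
    · exact belowA c hcm (.inl h)
    · exact betweenB c hpc hcm.le (.inl h)
    · exact ne1 c h
  have zTop : JoinedIn (crossingRect \ (B ∪ {-1, 1})) ⟨0, 2⟩ ⟨0, c⟩ := by
    refine top.trans ?_
    rw [eq0 m hm0]
    refine joinedIn_vertical fun t ht => ?_
    rw [uIcc_of_ge hcm.le] at ht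
    exact ⟨memR t (abs_le.mpr ⟨by linarith [ht.1], by linarith [ht.2]⟩),
      betweenB t (by linarith [ht.1]) ht.2⟩
  have zBot : JoinedIn (crossingRect \ (A ∪ {-1, 1})) ⟨0, c⟩ ⟨0, -2⟩ := by
    refine joinedIn_vertical fun t ht => ?_
    rw [uIcc_of_ge (by linarith)] at ht
    exact ⟨memR t (abs_le.mpr ⟨ht.1, by linarith [ht.2]⟩), belowA t (by linarith [ht.2])⟩
  refine ⟨⟨0, c⟩, hcK, ?_⟩
  have hφ : Continuous fun z : ℂ => max |z.re| (|z.im| / 2) :=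
    (Complex.continuous_re.abs).max (Complex.continuous_im.abs.div_const 2)
  -- An escaping path first hits the rectangle's boundary at some `v`. If `v` is in the lower half,
  -- top to `c` to `v` to bottom avoids `B`; if in the upper half, top to `v` to `c` to bottom
  -- avoids `A`. Both contradict crossing.
  have hsub : pathComponentIn (A ∪ B ∪ {-1, 1})ᶜ ⟨0, c⟩ ⊆
      {z : ℂ | max |z.re| (|z.im| / 2) < 1} := by
    intro w hw
    by_contra hw1
    obtain ⟨v, hv1, hv⟩ := JoinedIn.exists_level hw hφ (c := 1)
      (by simp only [abs_zero]; exact max_lt one_pos (by linarith)) (not_lt.mp hw1)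
    have hle : ∀ z : ℂ, max |z.re| (|z.im| / 2) ≤ 1 → z ∈ crossingRect := fun z hz =>
      ⟨(le_max_left _ _).trans hz, by linarith [(le_max_right |z.re| (|z.im| / 2)).trans hz]⟩
    have hvK := hv.target_mem.1
    have hvR := hle v hv1.le
    have hjoin : ∀ z : ℂ, z ∈ crossingRect → |z.re| = 1 ∧ z.im ≠ 0 ∨ |z.im| = 2 →
        z ∈ crossingRect \ (A ∪ B ∪ {-1, 1}) := by
      refine fun z hz h => ⟨hz, ?_⟩
      rintro (h' | h' | h')
      · have := hb z h'
        rcases h with h | h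
        · exact this.1.ne h.1
        · exact this.2.ne h
      · subst h'; simp at h
      · rw [mem_singleton_iff] at h'; subst h'; simp at h
    -- The boundary of the rectangle meets the real axis only in `-1` and `1`, which lie on the
    -- curve.
    have hvim : v.im ≠ 0 := by
      intro h0
      have hre : |v.re| = 1 := by simpa [h0] using hv1
      refine hvK (.inr ?_)
      rcases eq_or_eq_neg_of_abs_eq hre with h | h
      · exact .inr (Complex.ext (by simpa using h) (by simpa using h0))
      · exact .inl (Complex.ext (by simpa using h) (by simpa using h0))
    have hcase : |v.re| = 1 ∨ |v.im| = 2 := by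
      rcases max_choice |v.re| (|v.im| / 2) with h | h
      · exact .inl (h ▸ hv1)
      · right; rw [h] at hv1; linarith
    have hside : ∀ σ : ℝ, |σ| = 2 → 0 < σ * v.im →
        JoinedIn (crossingRect \ (A ∪ B ∪ {-1, 1})) v ⟨0, σ⟩ := by
      intro σ hσ hpos
      have h1 : JoinedIn (crossingRect \ (A ∪ B ∪ {-1, 1})) ⟨v.re, v.im⟩ ⟨v.re, σ⟩ := by
        refine joinedIn_vertical fun t ht => ?_
        rcases hcase with h | h
        · refine hjoin _ ⟨hvR.1, ?_⟩ (.inl ⟨h, ?_⟩)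
          · exact abs_le.mpr (uIcc_subset_Icc (abs_le.mp hvR.2) (abs_le.mp hσ.le) ht)
          · rintro (rfl : t = 0)
            rcases le_total v.im σ with hle | hle
            · rw [uIcc_of_le hle] at ht
              exact hpos.not_ge (mul_nonpos_of_nonneg_of_nonpos ht.2 ht.1)
            · rw [uIcc_of_ge hle] at ht
              exact hpos.not_ge (mul_nonpos_of_nonpos_of_nonneg ht.1 ht.2)
        · have hσv : σ = v.im := by
            rcases abs_eq_abs.mp (hσ.trans h.symm) with h | h
            · exact h
            · rw [h] at hpos; nlinarith [mul_self_nonneg v.im]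
          rw [hσv, uIcc_self, mem_singleton_iff] at ht
          exact hjoin _ ⟨hvR.1, by rw [ht]; exact hvR.2⟩ (.inr (by rw [ht]; exact h))
      refine h1.trans (joinedIn_horizontal fun t ht => hjoin _ ⟨?_, hσ.le⟩ (.inr hσ))
      exact abs_le.mpr (uIcc_subset_Icc (abs_le.mp hvR.1) (by simp) ht)
    have hzv : JoinedIn (crossingRect \ (A ∪ B ∪ {-1, 1})) ⟨0, c⟩ v :=
      hv.mono fun z hz => ⟨hle z hz.2, hz.1⟩
    rcases lt_or_gt_of_ne hvim with h | h
    · refine noB (zTop.trans ((hzv.trans (hside (-2) (by norm_num) (by linarith))).mono ?_))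
      exact sdiff_subset_sdiff_right (union_subset_union_left _ subset_union_right)
    · refine noA (JoinedIn.trans ((hzv.trans (hside 2 (by norm_num) (by linarith))).mono ?_).symm
        zBot)
      exact sdiff_subset_sdiff_right (union_subset_union_left _ subset_union_left)
  refine (Metric.isBounded_closedBall (x := (0 : ℂ)) (r := 3)).subset (hsub.trans fun z hz => ?_)
  have h1 := (le_max_left |z.re| (|z.im| / 2)).trans_lt hz
  have h2 := (le_max_right |z.re| (|z.im| / 2)).trans_lt hz
  rw [mem_closedBall_zero_iff]
  exact (Complex.norm_le_abs_re_add_abs_im z).trans (by linarith)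

/-- Two arcs from `-1` to `1` in the rectangle, disjoint away from their ends and with
interiors `A` and `B`, bound a region. -/
theorem exists_isBounded_pathComponentIn_of_arcs {A B : Set ℂ} (hA : IsPathConnected A)
    (hB : IsPathConnected B) (hKA : IsCompact (A ∪ {-1, 1})) (hKB : IsCompact (B ∪ {-1, 1}))
    (hjA : JoinedIn (A ∪ {-1, 1}) (-1) 1) (hjB : JoinedIn (B ∪ {-1, 1}) (-1) 1)
    (hdisj : Disjoint A B) (hb : ∀ z ∈ A ∪ B, |z.re| < 1 ∧ |z.im| < 2) :
    ∃ z₀ ∉ A ∪ B ∪ {-1, 1},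
      Bornology.IsBounded (pathComponentIn (A ∪ B ∪ {-1, 1})ᶜ z₀) := by
  have hK : IsCompact (A ∪ {-1, 1} ∪ (B ∪ {-1, 1})) := hKA.union hKB
  obtain ⟨w, hw0, hw⟩ := hjA.exists_level Complex.continuous_re (c := 0) (by simp) (by simp)
  obtain ⟨l, ⟨hlK, hl0⟩, hl⟩ := (hK.inter_right
    (isClosed_eq Complex.continuous_re continuous_const : IsClosed {z : ℂ | z.re = 0})).exists_isMaxOn
    ⟨w, .inl hw.target_mem.1, hw0⟩ Complex.continuous_im.continuousOn
  have hl' : ∀ z ∈ A ∪ B, z.re = 0 → z.im ≤ l.im := fun z hz h0 =>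
    hl ⟨hz.imp .inl .inl, h0⟩
  have hlpm : l ∉ ({-1, 1} : Set ℂ) := by
    rintro (h | h) <;> subst h <;> simp at hl0
  rcases hlK with (h | h) | (h | h)
  · exact exists_isBounded_pathComponentIn_of_highest_mem hA hKA hKB hjA hjB hdisj hb h hl0 hl'
  · exact absurd h hlpm
  · rw [union_comm A B] at hb hl' ⊢
    exact exists_isBounded_pathComponentIn_of_highest_mem hB hKB hKA hjB hjA hdisj.symm hb h hl0 hl'
  · exact absurd h hlpm

theorem Circle.insert_path_image_Ioo (u v : Circle) :
    Circle.path u v '' Ioo 0 1 ∪ {u, v} = range (Circle.path u v) := by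
  have h : (univ : Set unitInterval) = Ioo 0 1 ∪ {0, 1} := by
    rw [Ioo_union_both (zero_le_one)]
    ext t; simp [unitInterval.le_one']
  rw [← image_univ, h, image_union, image_pair, Path.source, Path.target]

theorem Circle.isPathConnected_path_image_Ioo (u v : Circle) :
    IsPathConnected (Circle.path u v '' Ioo 0 1) := by
  have h : Circle.path u v '' Ioo 0 1 = (Circle.path u v).extend '' Ioo (0 : ℝ) 1 := by
    ext z
    constructor
    · rintro ⟨t, ht, rfl⟩
      exact ⟨t, ht, Path.extend_apply _ t.2⟩
    · rintro ⟨t, ht, rfl⟩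
      exact ⟨⟨t, ht.1.le, ht.2.le⟩, ht, (Path.extend_apply _ ⟨ht.1.le, ht.2.le⟩).symm⟩
  rw [h]
  exact ((convex_Ioo 0 1).isPathConnected (nonempty_Ioo.mpr zero_lt_one)).image
    (Path.continuous_extend _)

/-- The two discs of radius 2 intersect in a lens that touches the lines `re = ±1` only at `±1`. -/
theorem abs_re_lt_one_of_dist_le {z : ℂ} (h1 : dist z (-1) ≤ 2) (h2 : dist z 1 ≤ 2)
    (hz1 : z ≠ -1) (hz2 : z ≠ 1) : |z.re| < 1 ∧ |z.im| < 2 := by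
  rw [Complex.dist_eq_re_im] at h1 h2
  have h1' := Real.sqrt_le_left (by norm_num) |>.mp h1
  have h2' := Real.sqrt_le_left (by norm_num) |>.mp h2
  simp only [Complex.neg_re, Complex.one_re, Complex.neg_im, Complex.one_im, neg_zero,
    sub_zero, sub_neg_eq_add] at h1' h2'
  refine ⟨abs_lt.mpr ⟨?_, ?_⟩, abs_lt.mpr ⟨?_, ?_⟩⟩
  · by_contra! h
    refine hz1 (Complex.ext ?_ ?_) <;> simp <;> nlinarith
  · by_contra! h
    refine hz2 (Complex.ext ?_ ?_) <;> simp <;> nlinarith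
  · nlinarith
  · nlinarith

/-- The points `u` and `v` cut the circle into two open arcs, whose images play the roles of `A` and
`B`. -/
theorem exists_isBounded_pathComponentIn_compl_range_of_dist_le {f : Circle → ℂ}
    (hf : Continuous f) (hinj : Function.Injective f) {u v : Circle} (hu : f u = -1) (hv : f v = 1)
    (hdist : ∀ x y, dist (f x) (f y) ≤ 2) :
    ∃ z₀ ∉ range f, Bornology.IsBounded (pathComponentIn (range f)ᶜ z₀) := by
  have huv : u ≠ v := by
    rintro rfl
    have := hu.symm.trans hv
    norm_num at this
  have hK : ∀ x y : Circle, f '' (Circle.path x y '' Ioo 0 1) ∪ {f x, f y}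
      = f '' range (Circle.path x y) := fun x y => by
    rw [← Circle.insert_path_image_Ioo, image_union, image_pair]
  have hKuv := hK u v
  have hKvu := hK v u
  rw [hu, hv] at hKuv hKvu
  rw [pair_comm] at hKvu
  have hcomp : ∀ x y : Circle, IsCompact (f '' range (Circle.path x y)) := fun x y =>
    (isCompact_range (Circle.path x y).continuous).image hf
  have hjoin : ∀ x y : Circle, JoinedIn (f '' range (Circle.path x y)) (f x) (f y) := fun x y =>
    ⟨(Circle.path x y).map hf, fun t => ⟨_, mem_range_self t, rfl⟩⟩
  have huniv : f '' (Circle.path u v '' Ioo 0 1) ∪ f '' (Circle.path v u '' Ioo 0 1) ∪ {-1, 1}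
      = range f := by
    rw [union_assoc, hKvu, ← Circle.compl_range_path huv.symm, ← image_union, compl_union_self,
      image_univ]
  have hdisj : Disjoint (Circle.path u v '' Ioo 0 1) (Circle.path v u '' Ioo 0 1) := by
    rw [← Circle.compl_range_path huv, Circle.insert_path_image_Ioo u v |>.symm]
    exact disjoint_compl_right.mono_left subset_union_left |>.mono_right subset_rfl
  have hpair : ∀ x y : Circle, x ≠ y → x ∉ Circle.path x y '' Ioo 0 1 ∧
      y ∉ Circle.path x y '' Ioo 0 1 := by
    intro x y hxy
    rw [← Circle.compl_range_path hxy.symm]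
    exact ⟨fun h => h (Path.target_mem_range _), fun h => h (Path.source_mem_range _)⟩
  rw [← huniv]
  refine exists_isBounded_pathComponentIn_of_arcs
    ((Circle.isPathConnected_path_image_Ioo u v).image hf)
    ((Circle.isPathConnected_path_image_Ioo v u).image hf)
    (hKuv ▸ hcomp u v) (hKvu ▸ hcomp v u) ?_ ?_ ?_ ?_
  · rw [hKuv, ← hu, ← hv]; exact hjoin u v
  · rw [hKvu, ← hu, ← hv]; exact (hjoin v u).symm
  · exact (disjoint_image_iff hinj).mpr hdisj
  · intro z hz
    rw [← image_union] at hz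
    obtain ⟨x, hx, rfl⟩ := hz
    have hxu : x ≠ u := by
      rintro rfl
      exact hx.elim (hpair x v huv).1 (hpair v x huv.symm).2
    have hxv : x ≠ v := by
      rintro rfl
      exact hx.elim (hpair u x huv).2 (hpair x u huv.symm).1
    exact abs_re_lt_one_of_dist_le (hu ▸ hdist x u) (hv ▸ hdist x v)
      (hu ▸ hinj.ne hxu) (hv ▸ hinj.ne hxv)

/-- A simple closed curve in the plane separates it: some path component of its complement
is bounded. -/
theorem exists_isBounded_pathComponentIn_compl_range {f : Circle → ℂ}
    (hf : Continuous f) (hinj : Function.Injective f) :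
    ∃ z₀ ∉ range f, Bornology.IsBounded (pathComponentIn (range f)ᶜ z₀) := by
  -- A pair realising the diameter is sent to `-1, 1` by an affine map, so all distances become at
  -- most 2.
  obtain ⟨⟨u, v⟩, -, hmax⟩ := isCompact_univ.exists_isMaxOn (univ_nonempty (α := Circle × Circle))
    (f := fun p => dist (f p.1) (f p.2)) (by fun_prop)
  replace hmax : ∀ x y, dist (f x) (f y) ≤ dist (f u) (f v) := fun x y => hmax (mem_univ (x, y))
  have huv : f v - f u ≠ 0 := by
    intro h
    have h1 := hmax 1 (-1)
    rw [sub_eq_zero.mp h, dist_self] at h1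
    have h2 : (1 : Circle) = -1 := hinj (dist_le_zero.mp h1)
    have h3 := congr_arg (fun z : Circle => (z : ℂ)) h2
    norm_num at h3
  set e : ℂ ≃ₜ ℂ := affineHomeomorph (2 / (f v - f u)) (-(f u + f v) / (f v - f u))
    (div_ne_zero two_ne_zero huv) with he
  have he_apply : ∀ z, e z = 2 / (f v - f u) * z + -(f u + f v) / (f v - f u) := fun z => rfl
  have hdist : ∀ x y, dist (e (f x)) (e (f y)) ≤ 2 := by
    intro x y
    rw [he_apply, he_apply, dist_add_right, dist_eq_norm, ← mul_sub, norm_mul, norm_div,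
      Complex.norm_ofNat, div_mul_eq_mul_div, div_le_iff₀ (norm_pos_iff.mpr huv)]
    have := hmax x y
    rw [dist_eq_norm, dist_comm (f u), dist_eq_norm] at this
    linarith
  obtain ⟨z₀, hz₀, hbdd⟩ := exists_isBounded_pathComponentIn_compl_range_of_dist_le
    (f := e ∘ f) (u := u) (v := v) (e.continuous.comp hf) (e.injective.comp hinj)
    (by rw [Function.comp_apply, he_apply]; field_simp; ring)
    (by rw [Function.comp_apply, he_apply]; field_simp; ring) hdist
  have hmem : ∀ z, e z ∈ range (e ∘ f) ↔ z ∈ range f := fun z => by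
    simp [e.injective.eq_iff]
  refine ⟨e.symm z₀, fun h => hz₀ ?_, ?_⟩
  · rw [← e.apply_symm_apply z₀, hmem]; exact h
  · obtain ⟨r, hr⟩ := hbdd.subset_closedBall 0
    refine (((isCompact_closedBall (0 : ℂ) r).image e.symm.continuous).isBounded).subset ?_
    intro w hw
    refine ⟨e w, hr ?_, e.symm_apply_apply w⟩
    have hw' : JoinedIn (range f)ᶜ (e.symm z₀) w := hw
    have := hw'.map e.continuous
    rw [e.apply_symm_apply] at this
    refine this.mono ?_
    rintro _ ⟨z, hz, rfl⟩
    exact fun h => hz ((hmem z).mp h)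

/-! ### Invariance of the disc boundary; circles and the line. -/

/-- A homeomorphism between subsets, as a pair of functions on the ambient types. -/
theorem Homeomorph.exists_extension {X Y : Type*} [TopologicalSpace X] [TopologicalSpace Y]
    [Nonempty X] [Nonempty Y] {s : Set X} {t : Set Y} (h : s ≃ₜ t) :
    ∃ (Φ : X → Y) (Ψ : Y → X), ContinuousOn Φ s ∧ ContinuousOn Ψ t ∧ MapsTo Φ s t ∧
      MapsTo Ψ t s ∧ LeftInvOn Ψ Φ s ∧ RightInvOn Ψ Φ t ∧ ∀ x (hx : x ∈ s), Φ x = h ⟨x, hx⟩ := by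
  classical
  obtain ⟨x₀⟩ := ‹Nonempty X›
  obtain ⟨y₀⟩ := ‹Nonempty Y›
  have hΦ : ∀ x (hx : x ∈ s), (fun x => if hx : x ∈ s then (h ⟨x, hx⟩ : Y) else y₀) x
      = h ⟨x, hx⟩ := fun x hx => by simp [hx]
  have hΨ : ∀ y (hy : y ∈ t), (fun y => if hy : y ∈ t then (h.symm ⟨y, hy⟩ : X) else x₀) y
      = h.symm ⟨y, hy⟩ := fun y hy => by simp [hy]
  generalize (fun x => if hx : x ∈ s then (h ⟨x, hx⟩ : Y) else y₀) = Φ at hΦ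
  generalize (fun y => if hy : y ∈ t then (h.symm ⟨y, hy⟩ : X) else x₀) = Ψ at hΨ
  have hΦm : MapsTo Φ s t := fun x hx => hΦ x hx ▸ (h ⟨x, hx⟩).2
  have hΨm : MapsTo Ψ t s := fun y hy => hΨ y hy ▸ (h.symm ⟨y, hy⟩).2
  refine ⟨Φ, Ψ, ?_, ?_, hΦm, hΨm, fun x hx => ?_, fun y hy => ?_, hΦ⟩
  · rw [continuousOn_iff_continuous_domRestrict]
    exact (continuous_subtype_val.comp h.continuous).congr fun x => (hΦ x x.2).symm
  · rw [continuousOn_iff_continuous_domRestrict]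
    exact (continuous_subtype_val.comp h.symm.continuous).congr fun y => (hΨ y y.2).symm
  · rw [hΨ _ (hΦm hx)]
    have : (⟨Φ x, hΦm hx⟩ : t) = h ⟨x, hx⟩ := Subtype.ext (hΦ x hx)
    rw [this, h.symm_apply_apply]
  · rw [hΦ _ (hΨm hy)]
    have : (⟨Ψ y, hΨm hy⟩ : s) = h.symm ⟨y, hy⟩ := Subtype.ext (hΨ y hy)
    rw [this, h.apply_symm_apply]

/-- A homeomorphism of the closed unit disc maps the unit circle to itself. -/
theorem norm_homeomorph_closedBall_eq_one
    (h : Metric.closedBall (0 : ℂ) 1 ≃ₜ Metric.closedBall (0 : ℂ) 1)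
    (x : Metric.closedBall (0 : ℂ) 1) (hx : ‖(x : ℂ)‖ = 1) : ‖(h x : ℂ)‖ = 1 := by
  by_contra hne
  have hq : ‖(h x : ℂ)‖ < 1 := lt_of_le_of_ne (mem_closedBall_zero_iff.mp (h x).2) hne
  obtain ⟨Φ, Ψ, hΦc, hΨc, hΦm, hΨm, hΨΦ, hΦΨ, hΦ⟩ := h.exists_extension
  -- A boundary point is extreme, so removing it leaves a convex set, on which `Φ - h x` has a
  -- logarithm. Were `h x` interior, composing with `Ψ` would give one for `z - h x` on a circle
  -- around `h x`.
  have hconv : Convex ℝ (Metric.closedBall (0 : ℂ) 1 \ {(x : ℂ)}) :=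
    ((convex_closedBall _ _).mem_extremePoints_iff_convex_sdiff.mp
      (StrictConvexSpace.sphere_subset_extremePoints_closedBall 0 one_ne_zero
        (mem_sphere_zero_iff_norm.mpr hx))).2
  have hΦx : Φ x = h x := hΦ x x.2
  obtain ⟨L, hLc, hL⟩ := hconv.exists_continuousOn_exp_eq (g := fun z => Φ z - h x)
    ((hΦc.mono sdiff_subset).sub continuousOn_const) (fun z hz h0 => hz.2 (by
      rw [sub_eq_zero, ← hΦx] at h0
      exact hΨΦ.injOn hz.1 x.2 h0))
  have hr : 0 < 1 - ‖(h x : ℂ)‖ := by linarith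
  have hsub : Metric.sphere (h x : ℂ) (1 - ‖(h x : ℂ)‖) ⊆ Metric.closedBall 0 1 := by
    intro z hz
    rw [mem_sphere_iff_norm] at hz
    rw [mem_closedBall_zero_iff]
    linarith [norm_le_norm_add_norm_sub' z (h x)]
  have hΨx : ∀ z ∈ Metric.sphere (h x : ℂ) (1 - ‖(h x : ℂ)‖),
      Ψ z ∈ Metric.closedBall (0 : ℂ) 1 \ {(x : ℂ)} := by
    refine fun z hz => ⟨hΨm (hsub hz), fun he => ?_⟩
    rw [mem_singleton_iff] at he
    have hz' : z = h x := by rw [← hΦx, ← he, hΦΨ (hsub hz)]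
    rw [hz', mem_sphere_iff_norm, sub_self, norm_zero] at hz
    exact hr.ne hz
  refine not_exists_log_on_sphere (h x) hr (L ∘ Ψ) (hLc.comp (hΨc.mono hsub) hΨx) fun z hz => ?_
  rw [Function.comp_apply, hL _ (hΨx z hz), hΦΨ (hsub hz)]

/-- There is no continuous injection of the circle into the line. -/
theorem Circle.not_injective_of_continuous {κ : Circle → ℝ} (hκ : Continuous κ) :
    ¬ Function.Injective κ := by
  intro hinj
  have hc : Continuous fun z : Circle => κ z - κ (-z) := hκ.sub (hκ.comp continuous_neg)
  have key : ∃ z, κ z - κ (-z) = 0 := by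
    rcases le_total (κ 1 - κ (-1)) 0 with h | h
    · exact mem_range_of_exists_le_of_exists_ge hc ⟨1, h⟩ ⟨-1, by rw [neg_neg]; linarith⟩
    · exact mem_range_of_exists_le_of_exists_ge hc ⟨-1, by rw [neg_neg]; linarith⟩ ⟨1, h⟩
  obtain ⟨z, hz⟩ := key
  have h2 : z = -z := hinj (sub_eq_zero.mp hz)
  exact Circle.neg_ne_self z h2.symm

/-! ### Simple closed curves in the disc; images of locally connected spaces. -/

/-- A compact subset `K` of the closed unit disc that does not contain the unit circle, does not
separate the open disc and is nowhere dense contains no simple closed curve. -/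
theorem not_range_subset_of_isPathConnected_sdiff {K : Set ℂ} (hK : IsClosed K)
    (hconn : IsPathConnected (Metric.ball 0 1 \ K)) (hdense : K ⊆ closure (Metric.ball 0 1 \ K))
    {p : ℂ} (hp : ‖p‖ = 1) (hpK : p ∉ K) (hKB : K ⊆ Metric.closedBall 0 1)
    {f : Circle → ℂ} (hf : Continuous f) (hinj : Function.Injective f) : ¬ range f ⊆ K := by
  intro hfK
  obtain ⟨z₀, hz₀, hbdd⟩ := exists_isBounded_pathComponentIn_compl_range hf hinj
  set U := pathComponentIn (range f)ᶜ z₀ with hU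
  have hopen : IsOpen U := (isCompact_range hf).isClosed.isOpen_compl.pathComponentIn z₀
  have hz₀U : z₀ ∈ U := mem_pathComponentIn_self hz₀
  have hUB : U ⊆ Metric.closedBall 0 1 := by
    intro w hw
    by_contra hw1
    rw [mem_closedBall_zero_iff, not_le] at hw1
    obtain ⟨r, hr⟩ := hbdd.subset_closedBall 0
    obtain ⟨n, hn⟩ := exists_nat_gt r
    -- Outside the disc the outward ray misses the curve and leaves every ball, contradicting
    -- boundedness.
    have hray : JoinedIn (range f)ᶜ w (((n : ℝ) + 1) • w) := by
      have hc : Continuous fun t : ℝ => t • w := by fun_prop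
      have := (((convex_Icc (1 : ℝ) (n + 1)).isPathConnected (nonempty_Icc.mpr
        (by linarith [n.cast_nonneg (α := ℝ)]))).image hc).joinedIn
        _ (mem_image_of_mem _ (left_mem_Icc.mpr (by linarith [n.cast_nonneg (α := ℝ)])))
        _ (mem_image_of_mem _ (right_mem_Icc.mpr (by linarith [n.cast_nonneg (α := ℝ)])))
      simp only [one_smul] at this
      refine this.mono ?_
      rintro _ ⟨t, ht, rfl⟩ hmem
      have h1 := mem_closedBall_zero_iff.mp (hKB (hfK hmem))
      rw [norm_smul, Real.norm_of_nonneg (by linarith [ht.1])] at h1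
      nlinarith [ht.1]
    have h1 := mem_closedBall_zero_iff.mp (hr (JoinedIn.trans hw hray))
    rw [norm_smul, Real.norm_of_nonneg (by positivity)] at h1
    nlinarith [n.cast_nonneg (α := ℝ)]
  have hUball : U ⊆ Metric.ball 0 1 := by
    rw [← interior_closedBall (0 : ℂ) one_ne_zero]
    exact interior_maximal hUB hopen
  obtain ⟨u, huU, hu⟩ : (U ∩ (Metric.ball 0 1 \ K)).Nonempty := by
    by_cases h : z₀ ∈ K
    · exact mem_closure_iff.mp (hdense h) U hopen hz₀U
    · exact ⟨z₀, hz₀U, hUball hz₀U, h⟩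
  obtain ⟨ε, hε, hεK⟩ := Metric.isOpen_iff.mp hK.isOpen_compl p hpK
  set δ := min (ε / 2) (1 / 2) with hδ
  have hδ0 : 0 < δ := lt_min (by linarith) (by norm_num)
  have hδε : δ < ε := (min_le_left _ _).trans_lt (by linarith)
  have hδ1 : δ < 1 := (min_le_right _ _).trans_lt (by norm_num)
  have hnear : ∀ t : ℝ, |t - 1| < ε → t • p ∉ K := by
    intro t ht
    refine hεK ?_
    rw [mem_ball_iff_norm]
    have : t • p - p = (t - 1) • p := by rw [sub_smul, one_smul]
    rwa [this, norm_smul, hp, mul_one]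
  have hin : (1 - δ) • p ∈ Metric.ball (0 : ℂ) 1 \ K := by
    refine ⟨?_, hnear _ (by rw [abs_lt]; constructor <;> linarith)⟩
    rw [mem_ball_zero_iff, norm_smul, hp, Real.norm_of_nonneg (by linarith)]
    linarith
  have hout : JoinedIn Kᶜ ((1 - δ) • p) ((1 + δ) • p) := by
    have hc : Continuous fun t : ℝ => t • p := by fun_prop
    refine ((((convex_Icc (1 - δ) (1 + δ)).isPathConnected (nonempty_Icc.mpr
      (by linarith))).image hc).joinedIn _ (mem_image_of_mem _ (left_mem_Icc.mpr (by linarith)))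
      _ (mem_image_of_mem _ (right_mem_Icc.mpr (by linarith)))).mono ?_
    rintro _ ⟨t, ht, rfl⟩
    exact hnear t (by rw [abs_lt]; constructor <;> linarith [ht.1, ht.2])
  -- From `u` in the enclosed region, move through the open disc off `K` to just inside `p`, then
  -- radially out past `p`.
  have hjoin : JoinedIn (range f)ᶜ u ((1 + δ) • p) :=
    (((hconn.joinedIn u hu _ hin).mono fun z hz => hz.2).trans hout).mono
      (compl_subset_compl.mpr hfK)
  have h1 := mem_closedBall_zero_iff.mp (hUB (JoinedIn.trans huU hjoin))
  rw [norm_smul, hp, Real.norm_of_nonneg (by linarith)] at h1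
  linarith

/-- A compact Hausdorff space that is a continuous image of a locally path connected compact
space is locally connected. -/
theorem locallyConnectedSpace_of_surjective {X Y : Type*} [TopologicalSpace X] [TopologicalSpace Y]
    [CompactSpace X] [LocallyPathConnectedSpace X] [T2Space Y] {q : X → Y} (hq : Continuous q)
    (hs : Function.Surjective q) : LocallyConnectedSpace Y :=
  have := (hq.isClosedMap.isQuotientMap hq hs).locallyPathConnectedSpace
  inferInstance

/-! ### Permeatings. -/

namespace Permeating

/-- Two charts of `D` differ by a self-homeomorphism of the closed disc, which preserves the unit
circle. -/
theorem mem_discBoundary_iff {D : Set (ℝ × ℝ)} (h : D ≃ₜ Metric.closedBall (0 : ℂ) 1) {x : ℝ × ℝ}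
    (hx : x ∈ D) : x ∈ discBoundary D ↔ ‖(h ⟨x, hx⟩ : ℂ)‖ = 1 := by
  refine ⟨?_, fun h1 => ⟨h, hx, h1⟩⟩
  rintro ⟨g, _, hg⟩
  simpa using norm_homeomorph_closedBall_eq_one (g.symm.trans h) (g ⟨x, hx⟩) hg

theorem IsHutch.subset {s : ℝ} {X D : Set (ℝ × ℝ)} (h : IsHutch s X D) : X ⊆ D := fun x hx => by
  by_cases hs : x ∈ edge s
  · exact (h.inter_edge_subset ⟨hx, hs⟩).1.1
  · exact (h.diff_edge_subset ⟨hx, hs⟩).1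

theorem IsPermeating.locallyConnectedSpace {s : ℝ} {X D : Set (ℝ × ℝ)} {η : ℝ × ℝ → ℝ × ℝ}
    (h : IsPermeating s X D η) : LocallyConnectedSpace X := by
  obtain ⟨A', ⟨e⟩, hA'sub, -, -, hA', -⟩ := h.exists_subarc
  have : LocallyPathConnectedSpace unitInterval := (convex_Icc (0 : ℝ) 1).locallyPathConnectedSpace
  have hcont : ContinuousOn η A' := h.continuousOn.mono fun x hx => (hA'sub hx).1.1
  have hmaps : MapsTo η A' X := fun x hx => hA' ▸ mem_image_of_mem η hx
  refine locallyConnectedSpace_of_surjective (q := hmaps.restrict ∘ e.symm)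
    ((hcont.mapsToRestrict hmaps).comp e.symm.continuous) ?_
  refine Function.Surjective.comp ?_ e.symm.surjective
  exact (MapsTo.restrict_surjective_iff hmaps).mpr hA'.ge

theorem IsPermeating.no_circle {s : ℝ} {X D : Set (ℝ × ℝ)} {η : ℝ × ℝ → ℝ × ℝ}
    (hX : IsCompact X) (hD : IsHutch s X D) (h : IsPermeating s X D η) (C : Set X) :
    ¬ Nonempty (C ≃ₜ Circle) := by
  rintro ⟨e⟩
  obtain ⟨g⟩ := hD.isDisc
  have hXD := hD.subset
  obtain ⟨Φ, Ψ, hΦc, hΨc, hΦm, hΨm, hΨΦ, hΦΨ, hΦ⟩ := g.exists_extension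
  have hbd : ∀ x ∈ D, (x ∈ discBoundary D ↔ ‖Φ x‖ = 1) := fun x hx => by
    rw [mem_discBoundary_iff g hx, hΦ x hx]
  have hint : ∀ x, x ∈ discInterior D ↔ x ∈ D ∧ Φ x ∈ Metric.ball 0 1 := by
    intro x
    refine and_congr_right fun hx => ?_
    rw [hbd x hx, mem_ball_zero_iff]
    exact ⟨lt_of_le_of_ne (mem_closedBall_zero_iff.mp (hΦm hx)), ne_of_lt⟩
  have hintΨ : Ψ '' Metric.ball 0 1 = discInterior D := by
    ext x
    rw [hint]
    constructor
    · rintro ⟨z, hz, rfl⟩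
      have hz' := Metric.ball_subset_closedBall hz
      exact ⟨hΨm hz', by rwa [hΦΨ hz']⟩
    · exact fun hx => ⟨Φ x, hx.2, hΨΦ hx.1⟩
  have hΦη : ContinuousOn (Φ ∘ η ∘ Ψ) (Metric.closedBall 0 1) :=
    hΦc.comp (h.continuousOn.comp hΨc hΨm) (h.mapsTo.comp hΨm)
  have himage : (Φ ∘ η ∘ Ψ) '' Metric.ball 0 1 = Metric.ball 0 1 \ Φ '' X := by
    rw [image_comp, image_comp, hintΨ, h.image_interior]
    ext z
    constructor
    · rintro ⟨x, hx, rfl⟩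
      refine ⟨((hint x).mp hx.1).2, ?_⟩
      rintro ⟨y, hy, hyx⟩
      exact hx.2 (hΨΦ.injOn (hXD hy) hx.1.1 hyx ▸ hy)
    · rintro ⟨hz, hzX⟩
      have hz' := Metric.ball_subset_closedBall hz
      refine ⟨Ψ z, ⟨(hint _).mpr ⟨hΨm hz', by rwa [hΦΨ hz']⟩, fun hX => hzX ⟨_, hX, hΦΨ hz'⟩⟩,
        hΦΨ hz'⟩
  have hconn : IsPathConnected (Metric.ball 0 1 \ Φ '' X) := by
    rw [← himage]
    exact ((convex_ball (0 : ℂ) 1).isPathConnected (Metric.nonempty_ball.mpr one_pos)).image'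
      (hΦη.mono Metric.ball_subset_closedBall)
  -- Each point of `X` is `η a` with `a` in `A'`, hence a limit of values of `η` on the interior of
  -- `D`.
  have hdense : Φ '' X ⊆ closure (Metric.ball 0 1 \ Φ '' X) := by
    obtain ⟨A', -, hA'sub, -, -, hA', -⟩ := h.exists_subarc
    rintro _ ⟨x, hx, rfl⟩
    rw [← hA'] at hx
    obtain ⟨a, ha, rfl⟩ := hx
    have haD : a ∈ D := (hA'sub ha).1.1
    rw [← himage]
    have hcl : closure (Metric.ball (0 : ℂ) 1) = Metric.closedBall 0 1 :=
      closure_ball 0 one_ne_zero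
    refine ContinuousOn.image_closure (hcl.symm ▸ hΦη) ⟨Φ a, hcl ▸ hΦm haD, ?_⟩
    simp only [Function.comp_apply, hΨΦ haD]
  -- Points of `X` on the boundary of `D` have second coordinate `s`; if they filled it, the first
  -- coordinate would inject a circle into the line.
  obtain ⟨p, hp, hpK⟩ : ∃ p : ℂ, ‖p‖ = 1 ∧ p ∉ Φ '' X := by
    by_contra! hall
    have hS : ∀ z : Circle, (z : ℂ) ∈ Metric.closedBall (0 : ℂ) 1 := fun z =>
      mem_closedBall_zero_iff.mpr z.norm_coe.le
    have hsnd : ∀ z : Circle, (Ψ z).2 = s := by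
      intro z
      obtain ⟨x, hx, hxz⟩ := hall z z.norm_coe
      have hΨz : Ψ z = x := by rw [← hxz, hΨΦ (hXD hx)]
      rw [hΨz]
      by_contra hs
      have := ((hint x).mp (hD.diff_edge_subset ⟨hx, fun h => hs h.2⟩)).2
      rw [hxz, mem_ball_zero_iff] at this
      exact this.ne z.norm_coe
    refine Circle.not_injective_of_continuous (κ := fun z => (Ψ z).1)
      (continuous_fst.comp (hΨc.comp_continuous continuous_subtype_val hS)) fun z w hzw => ?_
    have : Ψ z = Ψ w := Prod.ext hzw ((hsnd z).trans (hsnd w).symm)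
    exact Subtype.ext (hΦΨ.injOn (hS z) (hS w) this)
  have hmemX : ∀ z : Circle, ((e.symm z : X) : ℝ × ℝ) ∈ X := fun z => (e.symm z : X).2
  refine not_range_subset_of_isPathConnected_sdiff
    (hX.image_of_continuousOn (hΦc.mono hXD)).isClosed hconn hdense hp hpK
    (image_subset_iff.mpr fun x hx => hΦm (hXD hx)) (f := fun z => Φ (e.symm z : X)) ?_ ?_ ?_
  · exact (hΦc.mono hXD).comp_continuous
      (continuous_subtype_val.comp (continuous_subtype_val.comp e.symm.continuous)) hmemX
  · intro z w hzw
    exact e.symm.injective (Subtype.ext (Subtype.ext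
      (hΨΦ.injOn (hXD (hmemX z)) (hXD (hmemX w)) hzw)))
  · rintro _ ⟨z, rfl⟩
    exact mem_image_of_mem Φ (hmemX z)

end Permeating

theorem proposition4p5 (s : ℝ) (hs : s = -1 ∨ s = 1) (X : Set (ℝ × ℝ))
    (hX : Permeating.IsHanging s X) (hperm : Permeating.IsPermeable s X) :
    Permeating.IsDendrite X := by
  obtain ⟨-, D, hD, η, hη⟩ := hperm
  exact
    { isPeanoContinuum :=
        { compactSpace := isCompact_iff_compactSpace.mp hX.isCompact
          connectedSpace := isConnected_iff_connectedSpace.mp hX.isConnected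
          metrizableSpace := inferInstance
          locallyConnectedSpace := hη.locallyConnectedSpace }
      no_circle := hη.no_circle hX.isCompact hD }
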